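/- Let $H$ be a finite-dimensional complex Hilbert space of dimension $d$, and let $\|\cdot\|$ denote the operator norm. For density operators $\rho,\sigma$ on $H$ with the same spectrum, the quantum charging distance is $$D(\rho,\sigma)=\min T,$$ the minimum over all $T\ge 0$ for which there is a (measurable, possibly time-dependent) family of self-adjoint operators $V_t$, $t\in[0,T]$, with $\|V_t\|=1$ and $\sigma=U\rho U^\dagger$, where $U=U(T)=\mathrm{Texp}\big(-i\int_0^T V_t\,dt\big)$, i.e. $U(t)=1-i\int_0^t V_sU(s)\,ds$ for $0\le t\le T$. For a unitary $W$, $\ln W$ denotes the principal logarithm (eigenvalues in $i(-\pi,\pi]$). (a) Let $r_1,\dots,r_m$ be pairwise distinct reals, let $\{|r_i^k\rangle\}$ and $\{|s_i^k\rangle\}$ ($1\le i\le m$, $1\le k\le n_i$, $\sum_i n_i=d$) be orthonormal bases of $H$, and let $$\rho=\sum_{i=1}^m r_i\sum_{k=1}^{n_i}|r_i^k\rangle\langle r_i^k|,\qquad \sigma=\sum_{i=1}^m r_i\sum_{k=1}^{n_i}|s_i^k\rangle\langle s_i^k|$$ be density operators. Then the minimum defining $D(\rho,\sigma)$ is attained,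 and $$D(\rho,\sigma)=\min_{U_1,\dots,U_m}\Big\|\,i\ln\Big(\bigoplus_{i=1}^m U_i\ \sum_{i=1}^m\sum_{k=1}^{n_i}|s_i^k\rangle\langle r_i^k|\Big)\Big\|,$$ where the minimum (which is attained) is over all unitary operators $U_i$ on $\mathcal H_i=\mathrm{span}\{|s_i^k\rangle\}_{k=1}^{n_i}$. (b) Consequently $D$ depends only on the eigenspaces: if $\rho',\sigma'$ are density operators with decompositions of the same form, with pairwise distinct reals $r_i'$ and orthonormal bases $\{|r_i'^{k}\rangle\}$, $\{|s_i'^{k}\rangle\}$ such that $\mathrm{span}\{|r_i'^{k}\rangle\}_k=\mathrm{span}\{|r_i^{k}\rangle\}_k$ and $\mathrm{span}\{|s_i'^{k}\rangle\}_k=\mathrm{span}\{|s_i^{k}\rangle\}_k$ for every $i$, then $D(\rho',\sigma')=D(\rho,\sigma)$. (c) If $\rho=\sum_{i=1}^d r_i|r_i\rangle\langle r_i|$ and $\sigma=\sum_{i=1}^d r_i|s_i\rangle\langle s_i|$ are density operators with pairwise distinct $r_i$ and orthonormal bases $\{|r_i\rangle\}$, $\{|s_i\rangle\}$, then $$D(\rho,\sigma)=\min_{\phi_1,\dots,\phi_d\in\mathbb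 R}\Big\|\,i\ln\Big(\sum_{i=1}^d e^{i\phi_i}|s_i\rangle\langle r_i|\Big)\Big\|.$$ -/

import Mathlib

namespace QuantumCharging

open MeasureTheory Set

variable {H : Type*} [NormedAddCommGroup H] [InnerProductSpace ℂ H]
  [FiniteDimensional ℂ H] [CompleteSpace H]

/-- The operator `|x⟩⟨y|`, that is `z ↦ ⟪y, z⟫ x`. -/
noncomputable def ketBra (x y : H) : H →L[ℂ] H :=
  InnerProductSpace.rankOne ℂ x y

/-- Density operators: positive operators of trace one. -/
def IsDensityOperator (ρ : H →L[ℂ] H) : Prop :=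
  ρ.IsPositive ∧ LinearMap.trace ℂ H (ρ : H →ₗ[ℂ] H) = 1

/-- A charging Hamiltonian on `[0, T]`: a measurable, possibly time-dependent family of
self-adjoint operators of operator norm one. -/
structure IsChargingHamiltonian (V : ℝ → H →L[ℂ] H) (T : ℝ) : Prop where
  measurable : AEStronglyMeasurable V (volume.restrict (Icc 0 T))
  selfAdjoint : ∀ t ∈ Icc 0 T, IsSelfAdjoint (V t)
  norm_eq_one : ∀ t ∈ Icc 0 T, ‖V t‖ = 1

/-- `U t` is the time-ordered exponential `Texp (-i ∫₀ᵗ V_s ds)` for `t ∈ [0, T]`: the continuous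
solution of the Schrödinger equation `U' = -i V U`, `U 0 = 1`, in integrated form. -/
def IsTimeOrderedExp (V : ℝ → H →L[ℂ] H) (T : ℝ) (U : ℝ → H →L[ℂ] H) : Prop :=
  ContinuousOn U (Icc 0 T) ∧
    ∀ t ∈ Icc 0 T, U t = 1 - Complex.I • ∫ s in (0 : ℝ)..t, V s * U s

/-- The times `T ≥ 0` in which some charging Hamiltonian drives `ρ` to `σ`. -/
def chargingTimes (ρ σ : H →L[ℂ] H) : Set ℝ :=
  {T | 0 ≤ T ∧ ∃ V U : ℝ → H →L[ℂ] H, IsChargingHamiltonian V T ∧ IsTimeOrderedExp V T U ∧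
    σ = U T * ρ * star (U T)}

/-- The quantum charging distance. -/
noncomputable def chargingDistance (ρ σ : H →L[ℂ] H) : ℝ :=
  sInf (chargingTimes ρ σ)

/-- `‖i ln W‖` in operator norm, for a unitary `W` on a finite-dimensional space; `ln` is the
principal logarithm (eigenvalue angles in `(-π, π]`), applied to the eigenvalues of `W`. -/
noncomputable def normLog (W : H →L[ℂ] H) : ℝ :=
  ‖Complex.I • cfc Complex.log W‖

/-- `∑ᵢ rᵢ ∑ₖ |bᵢᵏ⟩⟨bᵢᵏ|`. -/
noncomputable def spectralSum {m : ℕ} {n : Fin m → ℕ} (r : Fin m → ℝ)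
    (b : OrthonormalBasis (Σ i, Fin (n i)) ℂ H) : H →L[ℂ] H :=
  ∑ i, (r i : ℂ) • ∑ k, ketBra (b ⟨i, k⟩) (b ⟨i, k⟩)

/-- The subspace spanned by the `i`-th block of the basis. -/
def blockSpan {m : ℕ} {n : Fin m → ℕ}
    (b : OrthonormalBasis (Σ i, Fin (n i)) ℂ H) (i : Fin m) : Submodule ℂ H :=
  Submodule.span ℂ (range fun k : Fin (n i) => b ⟨i, k⟩)

/-- The operator `⨁ᵢ Uᵢ` on `H`, for operators `Uᵢ` on subspaces `K i` of `H` (which, where it is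
used, are mutually orthogonal and together span `H`). -/
noncomputable def blockSum {m : ℕ} (K : Fin m → Submodule ℂ H)
    (U : ∀ i, K i ≃ₗᵢ[ℂ] K i) : H →L[ℂ] H :=
  ∑ i, (K i).subtypeL ∘L (U i : K i →L[ℂ] K i) ∘L (K i).orthogonalProjectionOnto

end QuantumCharging

/-!
For a unit vector `x`, the curve `U t x` moves on the unit sphere with speed at most
`‖V t‖ = 1`, so the angle between `x` and `U T x` is at most `T`; hence `‖U T - 1‖² ≤ 2 (1 - cos T)`
for `T ≤ π`. A unitary `W` satisfies `‖i ln W‖ = arccos (1 - ‖W - 1‖² / 2)`, so no Hamiltonian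
produces `W` in time less than `‖i ln W‖`, and the constant Hamiltonian `i ln W / ‖i ln W‖`
takes exactly that time. The distance is therefore the least `‖i ln W‖` over the compact set of
unitaries `W` with `σ = W ρ W†`, on which it is continuous. These are the unitaries that map the
eigenspaces of `ρ` onto those of `σ`, that is, one of them followed by any block-diagonal unitary.
-/

namespace QuantumCharging

open MeasureTheory Set

section Sphere

open InnerProductGeometry
open scoped NNReal

theorem lipschitzOnWith_intervalIntegral {E : Type*} [NormedAddCommGroup E] [NormedSpace ℝ E]
    {g : ℝ → E} {a b : ℝ} {C : ℝ≥0} (hg : IntervalIntegrable g volume a b)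
    (hC : ∀ t ∈ uIcc a b, ‖g t‖ ≤ C) :
    LipschitzOnWith C (fun t => ∫ s in a..t, g s) (uIcc a b) := by
  refine LipschitzOnWith.of_dist_le_mul fun t ht s hs => ?_
  have hsub {t : ℝ} (ht : t ∈ uIcc a b) : IntervalIntegrable g volume a t :=
    hg.mono_set (uIcc_subset_uIcc left_mem_uIcc ht)
  rw [dist_eq_norm, intervalIntegral.integral_interval_sub_left (hsub ht) (hsub hs), Real.dist_eq]
  exact intervalIntegral.norm_integral_le_of_norm_le_const fun r hr =>
    hC r (uIcc_subset_uIcc hs ht (uIoc_subset_uIcc hr))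

variable {E : Type*} [NormedAddCommGroup E] [InnerProductSpace ℝ E]

theorem norm_add_intervalIntegral_eq_norm [CompleteSpace E] {g : ℝ → E} {a b : ℝ} {C : ℝ≥0} {v : E}
    (hg : IntervalIntegrable g volume a b) (hC : ∀ t ∈ uIcc a b, ‖g t‖ ≤ C)
    (horth : ∀ t ∈ uIcc a b, inner ℝ (v + ∫ s in a..t, g s) (g t) = 0) :
    ‖v + ∫ s in a..b, g s‖ = ‖v‖ := by
  set f : ℝ → E := fun t => v + ∫ s in a..t, g s with hf
  have hac : AbsolutelyContinuousOnInterval (fun t => ‖f t‖) a b := by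
    have hlip := lipschitzWith_one_norm.comp_lipschitzOnWith
      ((LipschitzWith.const v).lipschitzOnWith.add (lipschitzOnWith_intervalIntegral hg hC))
    exact hlip.absolutelyContinuousOnInterval
  have hderiv : ∀ᵐ t, t ∈ uIcc a b → HasDerivAt (fun t => ‖f t‖ * ‖f t‖) 0 t := by
    filter_upwards [hg.ae_hasDerivAt_integral] with t ht htab
    have hsq := ((ht htab a left_mem_uIcc).const_add v).norm_sq
    simpa only [horth t htab, mul_zero, sq] using hsq
  obtain ⟨k, hk⟩ := (hac.mul hac).const_of_ae_hasDerivAt_zero hderiv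
  have hab : ‖f b‖ * ‖f b‖ = ‖f a‖ * ‖f a‖ := (hk b right_mem_uIcc).trans (hk a left_mem_uIcc).symm
  rw [mul_self_inj (norm_nonneg _) (norm_nonneg _)] at hab
  simpa [hf] using hab

theorem norm_sub_sq_eq_of_norm_eq_one {x y : E} (hx : ‖x‖ = 1) (hy : ‖y‖ = 1) :
    ‖x - y‖ ^ 2 = 2 * (1 - Real.cos (angle x y)) := by
  rw [norm_sub_sq_real, hx, hy, inner_eq_cos_angle_of_norm_eq_one hx hy]
  ring

theorem norm_sub_eq_two_mul_sin_half_angle {x y : E} (hx : ‖x‖ = 1) (hy : ‖y‖ = 1) :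
    ‖x - y‖ = 2 * Real.sin (angle x y / 2) := by
  have hsin : 0 ≤ Real.sin (angle x y / 2) :=
    Real.sin_nonneg_of_nonneg_of_le_pi (by linarith [angle_nonneg x y])
      (by linarith [angle_le_pi x y, Real.pi_pos])
  rw [← sq_eq_sq₀ (norm_nonneg _) (by positivity), norm_sub_sq_eq_of_norm_eq_one hx hy,
    mul_pow, Real.sin_sq_eq_half_sub]
  ring_nf

theorem angle_eq_two_mul_arcsin {x y : E} (hx : ‖x‖ = 1) (hy : ‖y‖ = 1) :
    angle x y = 2 * Real.arcsin (‖x - y‖ / 2) := by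
  rw [norm_sub_eq_two_mul_sin_half_angle hx hy, mul_div_cancel_left₀ _ two_ne_zero,
    Real.arcsin_sin (by linarith [angle_nonneg x y, Real.pi_pos]) (by linarith [angle_le_pi x y])]
  ring

theorem hasDerivAt_two_mul_arcsin_half (k t : ℝ) :
    HasDerivAt (fun s => 2 * Real.arcsin (k * (s - t) / 2)) k t := by
  have harcsin : HasDerivAt Real.arcsin 1 (k * (t - t) / 2) := by
    simpa using Real.hasDerivAt_arcsin (x := k * (t - t) / 2) (by simp) (by simp)
  have hinner := (((hasDerivAt_id t).sub_const t).const_mul k).div_const 2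
  exact ((harcsin.comp t hinner).const_mul 2).congr_deriv (by ring)

-- The rate is right because points at distance `d` subtend an angle `2 arcsin (d / 2) = d + o(d)`.
theorem angle_le_of_lipschitzOnWith {f : ℝ → E} {a b : ℝ} {K : ℝ≥0} (hab : a ≤ b)
    (hnorm : ∀ t ∈ Icc a b, ‖f t‖ = 1) (hf : LipschitzOnWith K f (Icc a b)) :
    angle (f a) (f b) ≤ K * (b - a) := by
  have hne : ∀ t ∈ Icc a b, f t ≠ 0 := fun t ht h => by simpa [h] using hnorm t ht
  have ha : a ∈ Icc a b := left_mem_Icc.2 hab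
  have hcont : ContinuousOn (fun t => angle (f a) (f t)) (Icc a b) := fun t ht =>
    (continuousAt_angle (hne a ha) (hne t ht)).comp_continuousWithinAt (f := fun t => (f a, f t))
      (continuousWithinAt_const.prodMk (hf.continuousOn t ht))
  have hlinear (t : ℝ) : HasDerivAt (fun s => K * (s - a)) (K : ℝ) t := by
    simpa using ((hasDerivAt_id t).sub_const a).const_mul (K : ℝ)
  refine image_le_of_liminf_slope_right_le_deriv_boundary hcont (by simp [angle_self (hne a ha)])
    (by fun_prop) (fun t _ => (hlinear t).hasDerivWithinAt)
    (fun t ht r hr => Filter.Eventually.frequently ?_) (right_mem_Icc.2 hab)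
  have hslope := (hasDerivWithinAt_iff_tendsto_slope' self_notMem_Ioi).1
    ((hasDerivAt_two_mul_arcsin_half K t).hasDerivWithinAt (s := Ioi t))
  filter_upwards [hslope.eventually_lt_const hr, Ioo_mem_nhdsGT ht.2] with s hs hts
  have ht' : t ∈ Icc a b := Ico_subset_Icc_self ht
  have hs' : s ∈ Icc a b := ⟨ht.1.trans hts.1.le, hts.2.le⟩
  have hpos : 0 < s - t := sub_pos.2 hts.1
  have hdist : ‖f t - f s‖ ≤ K * (s - t) := by
    simpa [dist_comm t, ← dist_eq_norm, Real.dist_eq, abs_of_pos hpos]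
      using hf.dist_le_mul t ht' s hs'
  have hincrement :=
    calc angle (f a) (f s) - angle (f a) (f t)
      _ ≤ angle (f t) (f s) := by linarith [angle_le_angle_add_angle (f a) (f t) (f s)]
      _ = 2 * Real.arcsin (‖f t - f s‖ / 2) :=
          angle_eq_two_mul_arcsin (hnorm t ht') (hnorm s hs')
      _ ≤ 2 * Real.arcsin (K * (s - t) / 2) := by gcongr
  refine lt_of_le_of_lt ?_ hs
  simp only [slope_def_field, sub_self, mul_zero, zero_div, Real.arcsin_zero, sub_zero]
  gcongr

end Sphere

section Evolution

variable {H : Type*} [NormedAddCommGroup H] [InnerProductSpace ℂ H] {V U : ℝ → H →L[ℂ] H} {T t : ℝ}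

theorem IsTimeOrderedExp.zero (hU : IsTimeOrderedExp V T U) (hT : 0 ≤ T) : U 0 = 1 := by
  simpa using hU.2 0 (left_mem_Icc.2 hT)

variable [CompleteSpace H]

theorem IsTimeOrderedExp.intervalIntegrable_mul (hV : IsChargingHamiltonian V T)
    (hU : IsTimeOrderedExp V T U) (ht : t ∈ Icc 0 T) :
    IntervalIntegrable (fun s => V s * U s) volume 0 t := by
  obtain ⟨C, hC⟩ := isCompact_Icc.exists_bound_of_continuousOn hU.1
  have hbound : ∀ s ∈ Icc 0 T, ‖V s * U s‖ ≤ 1 * C := fun s hs =>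
    norm_mul_le_of_le (hV.norm_eq_one s hs).le (hC s hs)
  have hint : IntegrableOn (fun s => V s * U s) (Icc 0 T) :=
    IntegrableOn.of_bound measure_Icc_lt_top
      (hV.measurable.mul (hU.1.aestronglyMeasurable measurableSet_Icc)) _
      (ae_restrict_of_forall_mem measurableSet_Icc hbound)
  exact (hint.mono_set (uIcc_subset_Icc (left_mem_Icc.2 (ht.1.trans ht.2)) ht)).intervalIntegrable

theorem IsTimeOrderedExp.intervalIntegrable_apply (hV : IsChargingHamiltonian V T)
    (hU : IsTimeOrderedExp V T U) (ht : t ∈ Icc 0 T) (x : H) :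
    IntervalIntegrable (fun s => -(Complex.I • V s (U s x))) volume 0 t := by
  have happly := (hU.intervalIntegrable_mul hV ht)
  rw [intervalIntegrable_iff] at happly ⊢
  exact ((happly.apply_continuousLinearMap x).smul Complex.I).neg

theorem IsTimeOrderedExp.apply_eq (hV : IsChargingHamiltonian V T) (hU : IsTimeOrderedExp V T U)
    (ht : t ∈ Icc 0 T) (x : H) :
    U t x = x + ∫ s in (0 : ℝ)..t, -(Complex.I • V s (U s x)) := by
  have happly : (∫ s in (0 : ℝ)..t, V s * U s) x = ∫ s in (0 : ℝ)..t, V s (U s x) :=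
    ContinuousLinearMap.intervalIntegral_apply (hU.intervalIntegrable_mul hV ht) x
  rw [hU.2 t ht, intervalIntegral.integral_neg, intervalIntegral.integral_smul, ← happly]
  simp [sub_eq_add_neg]

theorem IsChargingHamiltonian.norm_velocity_le (hV : IsChargingHamiltonian V T) (ht : t ∈ Icc 0 T)
    (y : H) : ‖-(Complex.I • V t y)‖ ≤ ‖y‖ := by
  rw [norm_neg, norm_smul, Complex.norm_I, one_mul]
  simpa using (V t).le_of_opNorm_le (hV.norm_eq_one t ht).le y

theorem re_inner_neg_I_smul_apply {A : H →L[ℂ] H} (hA : IsSelfAdjoint A) (y : H) :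
    (inner ℂ y (-(Complex.I • A y))).re = 0 := by
  have him : (inner ℂ y (A y)).im = 0 := hA.isSymmetric.im_inner_self_apply y
  simp [inner_neg_right, inner_smul_right, him]

theorem IsTimeOrderedExp.norm_apply (hV : IsChargingHamiltonian V T) (hU : IsTimeOrderedExp V T U)
    (ht : t ∈ Icc 0 T) (x : H) : ‖U t x‖ = ‖x‖ := by
  let _ := InnerProductSpace.rclikeToReal ℂ H
  obtain ⟨C, hC⟩ := isCompact_Icc.exists_bound_of_continuousOn hU.1
  have hsub : uIcc 0 t ⊆ Icc 0 T := uIcc_subset_Icc (left_mem_Icc.2 (ht.1.trans ht.2)) ht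
  rw [hU.apply_eq hV ht]
  refine norm_add_intervalIntegral_eq_norm (C := C.toNNReal * ‖x‖₊)
    (hU.intervalIntegrable_apply hV ht x) (fun s hs => ?_) fun s hs => ?_
  · exact (hV.norm_velocity_le (hsub hs) _).trans
      ((U s).le_of_opNorm_le ((hC s (hsub hs)).trans (Real.le_coe_toNNReal C)) x)
  · rw [← hU.apply_eq hV (hsub hs)]
    exact re_inner_neg_I_smul_apply (hV.selfAdjoint s (hsub hs)) _

theorem IsTimeOrderedExp.lipschitzOnWith_apply (hT : 0 ≤ T) (hV : IsChargingHamiltonian V T)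
    (hU : IsTimeOrderedExp V T U) (x : H) :
    LipschitzOnWith ‖x‖₊ (fun t => U t x) (Icc 0 T) := by
  have hspeed : ∀ s ∈ uIcc 0 T, ‖-(Complex.I • V s (U s x))‖ ≤ ‖x‖₊ := fun s hs => by
    rw [uIcc_of_le hT] at hs
    exact (hV.norm_velocity_le hs _).trans_eq (hU.norm_apply hV hs x)
  have hlip := lipschitzOnWith_intervalIntegral
    (hU.intervalIntegrable_apply hV (right_mem_Icc.2 hT) x) hspeed
  rw [uIcc_of_le hT] at hlip
  intro s hs t ht
  simp only [hU.apply_eq hV hs, hU.apply_eq hV ht, edist_add_left]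
  exact hlip hs ht

theorem IsTimeOrderedExp.norm_apply_sub_sq_le (hT : 0 ≤ T) (hTπ : T ≤ Real.pi)
    (hV : IsChargingHamiltonian V T) (hU : IsTimeOrderedExp V T U) {x : H} (hx : ‖x‖ = 1) :
    ‖U T x - x‖ ^ 2 ≤ 2 * (1 - Real.cos T) := by
  let _ := InnerProductSpace.rclikeToReal ℂ H
  have hnorm : ∀ t ∈ Icc 0 T, ‖U t x‖ = 1 := fun t ht => (hU.norm_apply hV ht x).trans hx
  have hangle : InnerProductGeometry.angle x (U T x) ≤ T := by
    simpa [hU.zero hT, hx] using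
      angle_le_of_lipschitzOnWith hT hnorm (hU.lipschitzOnWith_apply hT hV x)
  rw [norm_sub_rev, norm_sub_sq_eq_of_norm_eq_one hx (hnorm T (right_mem_Icc.2 hT))]
  have hcos := Real.cos_le_cos_of_nonneg_of_le_pi (InnerProductGeometry.angle_nonneg _ _) hTπ hangle
  gcongr

theorem IsTimeOrderedExp.norm_sub_one_sq_le (hT : 0 ≤ T) (hTπ : T ≤ Real.pi)
    (hV : IsChargingHamiltonian V T) (hU : IsTimeOrderedExp V T U) :
    ‖U T - 1‖ ^ 2 ≤ 2 * (1 - Real.cos T) := by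
  have hnonneg : 0 ≤ 2 * (1 - Real.cos T) := by linarith [Real.cos_le_one T]
  rw [← Real.le_sqrt (norm_nonneg _) hnonneg]
  exact ContinuousLinearMap.opNorm_le_of_unit_norm (Real.sqrt_nonneg _) fun x hx =>
    Real.le_sqrt_of_sq_le (hU.norm_apply_sub_sq_le hT hTπ hV hx)

end Evolution

section Logarithm

open Unitary selfAdjoint

variable {A : Type*} [CStarAlgebra A] {u : unitary A}

theorem cfc_log_eq_I_smul_argSelfAdjoint (hu : ContinuousOn Complex.arg (spectrum ℂ (u : A))) :
    cfc Complex.log (u : A) = Complex.I • (argSelfAdjoint u : A) := by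
  rw [argSelfAdjoint_coe, ← cfc_smul ..]
  refine cfc_congr fun z hz => ?_
  simp [Complex.log, spectrum.norm_eq_one_of_unitary u.2 hz, mul_comm]

theorem expUnitary_argSelfAdjoint_of_continuousOn
    (hu : ContinuousOn Complex.arg (spectrum ℂ (u : A))) :
    expUnitary (argSelfAdjoint u) = u := by
  ext
  rw [expUnitary_coe, argSelfAdjoint_coe, ← CFC.exp_eq_normedSpace_exp (𝕜 := ℂ),
    ← cfc_comp_smul .., ← cfc_comp' ..]
  conv_rhs => rw [← cfc_id' ℂ (u : A)]
  refine cfc_congr fun z hz => ?_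
  have hnorm : ‖z‖ = 1 := spectrum.norm_eq_one_of_unitary u.2 hz
  have hlog : Complex.I • (z.arg : ℂ) = Complex.log z := by simp [Complex.log, hnorm, mul_comm]
  rw [hlog, ← Complex.exp_eq_exp_ℂ, Complex.exp_log (norm_ne_zero_iff.1 (by simp [hnorm]))]

theorem norm_argSelfAdjoint_of_continuousOn
    (hu : ContinuousOn Complex.arg (spectrum ℂ (u : A))) :
    ‖(argSelfAdjoint u : A)‖ = Real.arccos (1 - ‖(u - 1 : A)‖ ^ 2 / 2) := by
  have hcos := norm_sq_expUnitary_sub_one (norm_argSelfAdjoint_le_pi u)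
  rw [expUnitary_argSelfAdjoint_of_continuousOn hu] at hcos
  exact (Real.arccos_eq_of_eq_cos (norm_nonneg _) (norm_argSelfAdjoint_le_pi u)
    (by linarith)).symm

theorem exists_isSelfAdjoint_norm_eq_one [Nontrivial A] {a : A} (ha : IsSelfAdjoint a) :
    ∃ v : A, IsSelfAdjoint v ∧ ‖v‖ = 1 ∧ a = ‖a‖ • v := by
  rcases eq_or_ne a 0 with rfl | h0
  · exact ⟨1, .one A, norm_one, by simp⟩
  · have hnorm : ‖a‖ ≠ 0 := norm_ne_zero_iff.2 h0
    exact ⟨‖a‖⁻¹ • a, (IsSelfAdjoint.all ‖a‖⁻¹).smul ha, by simp [norm_smul, hnorm],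
      by simp [smul_smul, hnorm]⟩

end Logarithm

section PrincipalLogarithm

open Unitary selfAdjoint

variable {H : Type*} [NormedAddCommGroup H] [InnerProductSpace ℂ H] [FiniteDimensional ℂ H]

theorem continuousOn_spectrum {Y : Type*} [TopologicalSpace Y] (f : ℂ → Y) (W : H →L[ℂ] H) :
    ContinuousOn f (spectrum ℂ W) := by
  rw [ContinuousLinearMap.spectrum_eq]
  exact (Module.End.finite_spectrum _).continuousOn f

variable [CompleteSpace H]

theorem normLog_eq_norm_argSelfAdjoint (W : unitary (H →L[ℂ] H)) :
    normLog (W : H →L[ℂ] H) = ‖(argSelfAdjoint W : H →L[ℂ] H)‖ := by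
  rw [normLog, cfc_log_eq_I_smul_argSelfAdjoint
    (continuousOn_spectrum Complex.arg (W : H →L[ℂ] H))]
  simp only [norm_smul, Complex.norm_I, one_mul]

theorem normLog_eq_arccos {W : H →L[ℂ] H} (hW : W ∈ unitary (H →L[ℂ] H)) :
    normLog W = Real.arccos (1 - ‖W - 1‖ ^ 2 / 2) :=
  (normLog_eq_norm_argSelfAdjoint ⟨W, hW⟩).trans
    (norm_argSelfAdjoint_of_continuousOn (u := ⟨W, hW⟩) (continuousOn_spectrum Complex.arg W))

theorem continuousOn_normLog : ContinuousOn normLog (unitary (H →L[ℂ] H) : Set (H →L[ℂ] H)) :=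
  ContinuousOn.congr (by fun_prop) fun _ hW => normLog_eq_arccos hW

end PrincipalLogarithm

section ChargingTimes

variable {H : Type*} [NormedAddCommGroup H] [InnerProductSpace ℂ H] [CompleteSpace H]

theorem isTimeOrderedExp_exp (A : H →L[ℂ] H) (T : ℝ) :
    IsTimeOrderedExp (fun _ => A) T fun t => NormedSpace.exp (t • -(Complex.I • A)) := by
  have hderiv (t : ℝ) : HasDerivAt (fun t : ℝ => NormedSpace.exp (t • -(Complex.I • A)))
      (-(Complex.I • A) * NormedSpace.exp (t • -(Complex.I • A))) t :=
    hasDerivAt_exp_smul_const' (𝕂 := ℝ) _ t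
  have hcont : Continuous fun t : ℝ => NormedSpace.exp (t • -(Complex.I • A)) :=
    continuous_iff_continuousAt.2 fun t => (hderiv t).continuousAt
  refine ⟨hcont.continuousOn, fun t _ => ?_⟩
  have hint := intervalIntegral.integral_eq_sub_of_hasDerivAt (a := 0) (b := t)
    (fun s _ => hderiv s) ((continuous_const.mul hcont).intervalIntegrable _ _)
  simp only [zero_smul, NormedSpace.exp_zero, neg_mul, smul_mul_assoc,
    intervalIntegral.integral_neg, intervalIntegral.integral_smul] at hint
  rw [sub_eq_add_neg, hint, add_sub_cancel]

/-- The unitaries that conjugate `ρ` into `σ`. The charging distance is the least value of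
`normLog` on this set. -/
def conjugators (ρ σ : H →L[ℂ] H) : Set (H →L[ℂ] H) :=
  {W | W ∈ unitary (H →L[ℂ] H) ∧ σ = W * ρ * star W}

variable {ρ σ : H →L[ℂ] H}

theorem mem_conjugators_iff_mul_eq_mul {W : H →L[ℂ] H} :
    W ∈ conjugators ρ σ ↔ W ∈ unitary (H →L[ℂ] H) ∧ σ * W = W * ρ := by
  refine and_congr_right fun hW => ⟨fun h => ?_, fun h => ?_⟩
  · rw [h, mul_assoc, Unitary.star_mul_self_of_mem hW, mul_one]
  · rw [← h, mul_assoc, Unitary.mul_star_self_of_mem hW, mul_one]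

theorem conjugators_eq_image_mul {S : H →L[ℂ] H} (hS : S ∈ conjugators ρ σ) :
    conjugators ρ σ = (· * S) '' conjugators σ σ := by
  obtain ⟨hSu, hSσ⟩ := mem_conjugators_iff_mul_eq_mul.1 hS
  simp only [Set.ext_iff, mem_image, mem_conjugators_iff_mul_eq_mul]
  refine fun W => ⟨fun ⟨hW, hWσ⟩ => ?_, ?_⟩
  · refine ⟨W * star S, ⟨mul_mem hW (Unitary.star_mem hSu), ?_⟩, ?_⟩
    · have hstar : ρ * star S = star S * σ :=
        calc ρ * star S = star S * (S * ρ) * star S := by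
              rw [← mul_assoc, Unitary.star_mul_self_of_mem hSu, one_mul]
          _ = star S * σ := by
              rw [← hSσ, mul_assoc, mul_assoc, Unitary.mul_star_self_of_mem hSu, mul_one]
      rw [← mul_assoc, hWσ, mul_assoc, hstar, mul_assoc]
    · rw [mul_assoc, Unitary.star_mul_self_of_mem hSu, mul_one]
  · rintro ⟨B, ⟨hB, hBσ⟩, rfl⟩
    exact ⟨mul_mem hB hSu, by rw [← mul_assoc, hBσ, mul_assoc, hSσ, mul_assoc]⟩

variable [FiniteDimensional ℂ H]

theorem mem_unitary_of_norm_map {W : H →L[ℂ] H} (hW : ∀ x, ‖W x‖ = ‖x‖) :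
    W ∈ unitary (H →L[ℂ] H) := by
  have hcoe : Unitary.linearIsometryEquiv.symm
      (LinearIsometry.toLinearIsometryEquiv ⟨(W : H →ₗ[ℂ] H), hW⟩ rfl) = W :=
    ContinuousLinearMap.ext fun _ => rfl
  exact hcoe ▸ SetLike.coe_mem _

theorem IsTimeOrderedExp.normLog_le {V U : ℝ → H →L[ℂ] H} {T : ℝ} (hT : 0 ≤ T)
    (hV : IsChargingHamiltonian V T) (hU : IsTimeOrderedExp V T U) : normLog (U T) ≤ T := by
  rw [normLog_eq_arccos (mem_unitary_of_norm_map (hU.norm_apply hV (right_mem_Icc.2 hT)))]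
  rcases le_total T Real.pi with hTπ | hTπ
  · refine (Real.arccos_le_arccos ?_).trans_eq (Real.arccos_cos hT hTπ)
    linarith [hU.norm_sub_one_sq_le hT hTπ hV]
  · exact (Real.arccos_le_pi _).trans hTπ

theorem isCompact_conjugators (ρ σ : H →L[ℂ] H) : IsCompact (conjugators ρ σ) := by
  have : ProperSpace (H →L[ℂ] H) := FiniteDimensional.proper ℂ _
  refine Metric.isCompact_of_isClosed_isBounded (isClosed_unitary.inter ?_) ?_
  · exact isClosed_eq (by fun_prop) (by fun_prop)
  · exact isBounded_iff_forall_norm_le.2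
      ⟨1, fun W hW => ContinuousLinearMap.opNorm_le_bound _ zero_le_one fun x => by
        rw [ContinuousLinearMap.norm_map_of_mem_unitary hW.1, one_mul]⟩

variable [Nontrivial H]

theorem normLog_mem_chargingTimes {W : H →L[ℂ] H} (hW : W ∈ conjugators ρ σ) :
    normLog W ∈ chargingTimes ρ σ := by
  lift W to unitary (H →L[ℂ] H) using hW.1
  obtain ⟨v, hv, hv1, hWv⟩ :=
    exists_isSelfAdjoint_norm_eq_one (selfAdjoint.mem_iff.1 (Unitary.argSelfAdjoint W).2)
  refine ⟨norm_nonneg _, fun _ => -v, _, ⟨aestronglyMeasurable_const, fun _ _ => hv.neg,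
    fun _ _ => (norm_neg v).trans hv1⟩, isTimeOrderedExp_exp (-v) _, ?_⟩
  have hexp : NormedSpace.exp (normLog (W : H →L[ℂ] H) • -(Complex.I • -v)) = W := by
    have harg := expUnitary_argSelfAdjoint_of_continuousOn
      (continuousOn_spectrum Complex.arg (W : H →L[ℂ] H))
    rw [smul_neg Complex.I, neg_neg, smul_comm, normLog_eq_norm_argSelfAdjoint, ← hWv,
      ← selfAdjoint.expUnitary_coe, harg]
  rw [hexp]
  exact hW.2

theorem isLeast_chargingDistance (hne : (conjugators ρ σ).Nonempty) :
    IsLeast (chargingTimes ρ σ) (chargingDistance ρ σ) ∧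
      IsLeast (normLog '' conjugators ρ σ) (chargingDistance ρ σ) := by
  obtain ⟨W, hW, hmin⟩ := (isCompact_conjugators ρ σ).exists_isMinOn hne
    (continuousOn_normLog.mono fun W hW => hW.1)
  have hleast : IsLeast (chargingTimes ρ σ) (normLog W) := by
    refine ⟨normLog_mem_chargingTimes hW, ?_⟩
    rintro T ⟨hT, V, U, hV, hU, hσ⟩
    have hUT : U T ∈ conjugators ρ σ :=
      ⟨mem_unitary_of_norm_map (hU.norm_apply hV (right_mem_Icc.2 hT)), hσ⟩
    exact (hmin hUT).trans (hU.normLog_le hT hV)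
  have hdist : chargingDistance ρ σ = normLog W := hleast.csInf_eq
  rw [hdist]
  exact ⟨hleast, mem_image_of_mem _ hW, forall_mem_image.2 fun _ hW' => hmin hW'⟩

end ChargingTimes

section Bases

variable {H : Type*} [NormedAddCommGroup H] [InnerProductSpace ℂ H] {ι : Type*}

theorem orthonormal_smul {a : ι → ℂ} (ha : ∀ i, ‖a i‖ = 1) {v : ι → H} (hv : Orthonormal ℂ v) :
    Orthonormal ℂ fun i => a i • v i := by
  refine ⟨fun i => by rw [norm_smul, ha, hv.1, mul_one], fun i j hij => ?_⟩
  simp only [inner_smul_left, inner_smul_right, hv.2 hij, mul_zero]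

variable [Fintype ι]

theorem ext_on_orthonormalBasis {A B : H →L[ℂ] H} (b : OrthonormalBasis ι ℂ H)
    (h : ∀ j, A (b j) = B (b j)) : A = B :=
  ContinuousLinearMap.coe_injective (b.toBasis.ext fun j => by simpa using h j)

theorem sum_smul_ketBra_apply (a : ι → ℂ) (b : OrthonormalBasis ι ℂ H) (c : ι → H) (j : ι) :
    (∑ i, a i • ketBra (c i) (b i)) (b j) = a j • c j := by
  classical
  simp [ketBra, sum_apply, b.inner_eq_ite]

theorem inner_sum_smul_ketBra_apply (a : ι → ℂ) (c : OrthonormalBasis ι ℂ H) (j : ι) (y : H) :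
    inner ℂ (c j) ((∑ i, a i • ketBra (c i) (c i)) y) = a j * inner ℂ (c j) y := by
  classical
  simp [ketBra, sum_apply, c.inner_eq_ite]

theorem sum_smul_ketBra_apply_eq_smul_iff (a : ι → ℂ) (c : OrthonormalBasis ι ℂ H) (μ : ℂ)
    (y : H) : (∑ i, a i • ketBra (c i) (c i)) y = μ • y ↔ ∀ j, a j ≠ μ → inner ℂ (c j) y = 0 :=
  calc (∑ i, a i • ketBra (c i) (c i)) y = μ • y
    _ ↔ ∀ j, a j * inner ℂ (c j) y = μ * inner ℂ (c j) y := by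
      refine ⟨fun h j => ?_, fun h => InnerProductSpace.ext_inner_left_basis c.toBasis fun j => ?_⟩
      · rw [← inner_sum_smul_ketBra_apply, h, inner_smul_right]
      · rw [OrthonormalBasis.coe_toBasis, inner_sum_smul_ketBra_apply, inner_smul_right, h]
    _ ↔ ∀ j, a j ≠ μ → inner ℂ (c j) y = 0 := by
      simp only [mul_eq_mul_right_iff, or_iff_not_imp_left, ne_eq]

variable [CompleteSpace H]

theorem mem_conjugators_sum_smul_ketBra_iff (a : ι → ℂ) (b c : OrthonormalBasis ι ℂ H)
    (W : H →L[ℂ] H) :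
    W ∈ conjugators (∑ i, a i • ketBra (b i) (b i)) (∑ i, a i • ketBra (c i) (c i)) ↔
      W ∈ unitary (H →L[ℂ] H) ∧ ∀ j i, a i ≠ a j → inner ℂ (c i) (W (b j)) = 0 := by
  rw [mem_conjugators_iff_mul_eq_mul]
  refine and_congr_right fun _ => ?_
  simp only [← sum_smul_ketBra_apply_eq_smul_iff]
  refine ⟨fun h j => ?_, fun h => ext_on_orthonormalBasis b fun j => ?_⟩
  · rw [← mul_apply_eq_comp, h, mul_apply_eq_comp,
      sum_smul_ketBra_apply, map_smul]
  · rw [mul_apply_eq_comp, mul_apply_eq_comp, h,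
      sum_smul_ketBra_apply, map_smul]

variable [FiniteDimensional ℂ H]

theorem mem_unitary_of_orthonormal {W : H →L[ℂ] H} (b : OrthonormalBasis ι ℂ H)
    (hW : Orthonormal ℂ fun j => W (b j)) : W ∈ unitary (H →L[ℂ] H) := by
  have hb : Orthonormal ℂ b.toBasis := by simp
  exact mem_unitary_of_norm_map fun x =>
    ((W : H →ₗ[ℂ] H).isometryOfOrthonormal hb (by simpa using! hW)).norm_map x

theorem sum_smul_ketBra_mem_unitary {a : ι → ℂ} (ha : ∀ i, ‖a i‖ = 1)
    (b c : OrthonormalBasis ι ℂ H) :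
    ∑ i, a i • ketBra (c i) (b i) ∈ unitary (H →L[ℂ] H) := by
  refine mem_unitary_of_orthonormal b ?_
  simpa only [sum_smul_ketBra_apply] using orthonormal_smul ha c.orthonormal

theorem sum_smul_ketBra_mem_conjugators {u : ι → ℂ} (hu : ∀ i, ‖u i‖ = 1) (a : ι → ℂ)
    (b c : OrthonormalBasis ι ℂ H) :
    ∑ i, u i • ketBra (c i) (b i) ∈
      conjugators (∑ i, a i • ketBra (b i) (b i)) (∑ i, a i • ketBra (c i) (c i)) := by
  refine (mem_conjugators_sum_smul_ketBra_iff a b c _).2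
    ⟨sum_smul_ketBra_mem_unitary hu b c, fun j i hij => ?_⟩
  rw [sum_smul_ketBra_apply, inner_smul_right, c.orthonormal.2 (ne_of_apply_ne a hij), mul_zero]

theorem conjugators_of_injective {a : ι → ℂ} (ha : Function.Injective a)
    (b c : OrthonormalBasis ι ℂ H) :
    conjugators (∑ i, a i • ketBra (b i) (b i)) (∑ i, a i • ketBra (c i) (c i)) =
      range fun φ : ι → ℝ => ∑ i, Complex.exp (Complex.I * (φ i : ℂ)) • ketBra (c i) (b i) := by
  refine Subset.antisymm (fun W hW => ?_) (range_subset_iff.2 fun φ =>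
    sum_smul_ketBra_mem_conjugators (fun i => ?_) a b c)
  · obtain ⟨hWu, horth⟩ := (mem_conjugators_sum_smul_ketBra_iff a b c W).1 hW
    have hWb (j : ι) : W (b j) = inner ℂ (c j) (W (b j)) • c j := by
      conv_lhs => rw [← c.sum_repr' (W (b j))]
      refine Finset.sum_eq_single j (fun i _ hij => ?_) (by simp)
      rw [horth j i (ha.ne hij), zero_smul]
    have hphase (j : ι) : ∃ θ : ℝ, Complex.exp (θ * Complex.I) = inner ℂ (c j) (W (b j)) := by
      rw [← Complex.norm_eq_one_iff, ← mul_one ‖_‖, ← c.norm_eq_one j, ← norm_smul, ← hWb,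
        ContinuousLinearMap.norm_map_of_mem_unitary hWu, b.norm_eq_one, c.norm_eq_one]
    choose φ hφ using hphase
    refine ⟨φ, ext_on_orthonormalBasis b fun j => ?_⟩
    rw [sum_smul_ketBra_apply, mul_comm, hφ, ← hWb]
  · rw [mul_comm, Complex.norm_exp_ofReal_mul_I]

end Bases

section OrthogonalBlocks

variable {H : Type*} [NormedAddCommGroup H] [InnerProductSpace ℂ H] [FiniteDimensional ℂ H]
  {m : ℕ} {K : Fin m → Submodule ℂ H}

theorem blockSum_apply (U : ∀ i, K i ≃ₗᵢ[ℂ] K i) (x : H) :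
    blockSum K U x = ∑ i, (U i ((K i).orthogonalProjectionOnto x) : H) := by
  simp [blockSum, sum_apply]

theorem blockSum_apply_of_mem (hK : OrthogonalFamily ℂ (fun i => K i) fun i => (K i).subtypeₗᵢ)
    (U : ∀ i, K i ≃ₗᵢ[ℂ] K i) {i : Fin m} (y : K i) : blockSum K U y = U i y := by
  rw [blockSum_apply, Finset.sum_eq_single i]
  · rw [Submodule.orthogonalProjectionOnto_mem_subspace_eq_self]
  · intro j _ hji
    have hproj : (K j).orthogonalProjectionOnto (y : H) = 0 :=
      Submodule.orthogonalProjectionOnto_eq_zero_iff.2 fun x hx => hK hji ⟨x, hx⟩ y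
    simp [hproj]
  · simp

theorem sum_orthogonalProjectionOnto
    (hK : OrthogonalFamily ℂ (fun i => K i) fun i => (K i).subtypeₗᵢ) (htop : iSup K = ⊤) (x : H) :
    ∑ i, ((K i).orthogonalProjectionOnto x : H) = x :=
  hK.sum_projection_of_mem_iSup x (htop ▸ Submodule.mem_top)

theorem norm_blockSum_apply (hK : OrthogonalFamily ℂ (fun i => K i) fun i => (K i).subtypeₗᵢ)
    (htop : iSup K = ⊤) (U : ∀ i, K i ≃ₗᵢ[ℂ] K i) (x : H) : ‖blockSum K U x‖ = ‖x‖ := by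
  rw [← sq_eq_sq₀ (norm_nonneg _) (norm_nonneg _)]
  calc ‖blockSum K U x‖ ^ 2
    _ = ∑ i, ‖U i ((K i).orthogonalProjectionOnto x)‖ ^ 2 := by
      rw [blockSum_apply]
      exact hK.norm_sum (fun i => U i ((K i).orthogonalProjectionOnto x)) Finset.univ
    _ = ∑ i, ‖(K i).orthogonalProjectionOnto x‖ ^ 2 := by simp only [LinearIsometryEquiv.norm_map]
    _ = ‖∑ i, ((K i).orthogonalProjectionOnto x : H)‖ ^ 2 :=
      (hK.norm_sum (fun i => (K i).orthogonalProjectionOnto x) Finset.univ).symm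
    _ = ‖x‖ ^ 2 := by rw [sum_orthogonalProjectionOnto hK htop]

theorem exists_linearIsometryEquiv_of_mapsTo {B : H →L[ℂ] H} (hB : ∀ x, ‖B x‖ = ‖x‖)
    {L : Submodule ℂ H} (hL : ∀ y ∈ L, B y ∈ L) : ∃ U : L ≃ₗᵢ[ℂ] L, ∀ y : L, (U y : H) = B y :=
  ⟨LinearIsometry.toLinearIsometryEquiv
    ⟨(B : H →ₗ[ℂ] H).restrict hL, fun y => hB y⟩ rfl, fun _ => rfl⟩

theorem range_blockSum [CompleteSpace H]
    (hK : OrthogonalFamily ℂ (fun i => K i) fun i => (K i).subtypeₗᵢ) (htop : iSup K = ⊤) :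
    range (blockSum K) = {B | B ∈ unitary (H →L[ℂ] H) ∧ ∀ i, ∀ y ∈ K i, B y ∈ K i} := by
  refine Subset.antisymm (range_subset_iff.2 fun U => ⟨?_, fun i y hy => ?_⟩) ?_
  · exact mem_unitary_of_norm_map (norm_blockSum_apply hK htop U)
  · exact blockSum_apply_of_mem hK U ⟨y, hy⟩ ▸ Subtype.coe_prop _
  · rintro B ⟨hB, hmaps⟩
    choose U hU using fun i => exists_linearIsometryEquiv_of_mapsTo
      (ContinuousLinearMap.norm_map_of_mem_unitary hB) (hmaps i)
    refine ⟨U, ContinuousLinearMap.ext fun x => ?_⟩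
    conv_rhs => rw [← sum_orthogonalProjectionOnto hK htop x]
    simp only [blockSum_apply, hU, map_sum]

end OrthogonalBlocks

section SpectralSums

variable {H : Type*} [NormedAddCommGroup H] [InnerProductSpace ℂ H]
  {m : ℕ} {n : Fin m → ℕ} {r : Fin m → ℝ}

theorem spectralSum_eq (r : Fin m → ℝ) (b : OrthonormalBasis (Σ i, Fin (n i)) ℂ H) :
    spectralSum r b = ∑ j, (r j.1 : ℂ) • ketBra (b j) (b j) := by
  simp only [spectralSum, Finset.smul_sum, Fintype.sum_sigma]

theorem orthogonalFamily_blockSpan (c : OrthonormalBasis (Σ i, Fin (n i)) ℂ H) :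
    OrthogonalFamily ℂ (fun i => blockSpan c i) fun i => (blockSpan c i).subtypeₗᵢ := by
  refine OrthogonalFamily.of_pairwise fun i j hij => Submodule.isOrtho_span.2 ?_
  rintro _ ⟨k, rfl⟩ _ ⟨l, rfl⟩
  exact c.orthonormal.2 (ne_of_apply_ne Sigma.fst hij)

theorem mem_blockSpan (c : OrthonormalBasis (Σ i, Fin (n i)) ℂ H) (j : Σ i, Fin (n i)) :
    c j ∈ blockSpan c j.1 :=
  Submodule.subset_span ⟨j.2, rfl⟩

theorem iSup_blockSpan (c : OrthonormalBasis (Σ i, Fin (n i)) ℂ H) : ⨆ i, blockSpan c i = ⊤ := by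
  rw [eq_top_iff, ← c.toBasis.span_eq, Submodule.span_le, c.coe_toBasis]
  exact range_subset_iff.2 fun j => le_iSup (blockSpan c) j.1 (mem_blockSpan c j)

theorem mem_blockSpan_iff (c : OrthonormalBasis (Σ i, Fin (n i)) ℂ H) (i : Fin m) (y : H) :
    y ∈ blockSpan c i ↔ ∀ j, j.1 ≠ i → inner ℂ (c j) y = 0 := by
  refine ⟨fun hy j hj => ?_, fun h => ?_⟩
  · exact orthogonalFamily_blockSpan c hj ⟨c j, mem_blockSpan c j⟩ ⟨y, hy⟩
  · rw [← c.sum_repr' y]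
    refine Submodule.sum_mem _ fun j _ => ?_
    rcases eq_or_ne j.1 i with rfl | hj
    · exact Submodule.smul_mem _ _ (mem_blockSpan c j)
    · rw [h j hj, zero_smul]
      exact Submodule.zero_mem _

theorem forall_mem_blockSpan_iff (b : OrthonormalBasis (Σ i, Fin (n i)) ℂ H) (A : H →L[ℂ] H)
    (K : Fin m → Submodule ℂ H) :
    (∀ i, ∀ y ∈ blockSpan b i, A y ∈ K i) ↔ ∀ j, A (b j) ∈ K j.1 := by
  refine ⟨fun h j => h j.1 _ (mem_blockSpan b j), fun h i => ?_⟩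
  have hle : blockSpan b i ≤ (K i).comap (A : H →ₗ[ℂ] H) :=
    Submodule.span_le.2 (range_subset_iff.2 fun k => h ⟨i, k⟩)
  exact hle

variable [CompleteSpace H]

theorem mem_conjugators_spectralSum_iff (hr : Function.Injective r)
    (b c : OrthonormalBasis (Σ i, Fin (n i)) ℂ H) (W : H →L[ℂ] H) :
    W ∈ conjugators (spectralSum r b) (spectralSum r c) ↔
      W ∈ unitary (H →L[ℂ] H) ∧ ∀ i, ∀ y ∈ blockSpan b i, W y ∈ blockSpan c i := by
  rw [spectralSum_eq, spectralSum_eq,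
    mem_conjugators_sum_smul_ketBra_iff fun j : Σ i, Fin (n i) => (r j.1 : ℂ),
    forall_mem_blockSpan_iff]
  simp only [mem_blockSpan_iff, ne_eq, Complex.ofReal_inj, hr.eq_iff]

variable [FiniteDimensional ℂ H]

theorem sum_ketBra_mem_conjugators (r : Fin m → ℝ) (b c : OrthonormalBasis (Σ i, Fin (n i)) ℂ H) :
    ∑ i, ∑ k, ketBra (c ⟨i, k⟩) (b ⟨i, k⟩) ∈ conjugators (spectralSum r b) (spectralSum r c) := by
  simpa only [spectralSum_eq, Pi.one_apply, one_smul, Fintype.sum_sigma] using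
    sum_smul_ketBra_mem_conjugators (u := 1) (fun _ => norm_one) (fun j => (r j.1 : ℂ)) b c

theorem conjugators_spectralSum (hr : Function.Injective r)
    (b c : OrthonormalBasis (Σ i, Fin (n i)) ℂ H) :
    conjugators (spectralSum r b) (spectralSum r c) =
      range fun U : ∀ i, blockSpan c i ≃ₗᵢ[ℂ] blockSpan c i =>
        blockSum (blockSpan c) U * ∑ i, ∑ k, ketBra (c ⟨i, k⟩) (b ⟨i, k⟩) := by
  have hself :
      conjugators (spectralSum r c) (spectralSum r c) = range (blockSum (blockSpan c)) := by
    rw [range_blockSum (orthogonalFamily_blockSpan c) (iSup_blockSpan c)]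
    exact Set.ext (mem_conjugators_spectralSum_iff hr c c)
  rw [conjugators_eq_image_mul (sum_ketBra_mem_conjugators r b c), hself, ← range_comp]
  rfl

end SpectralSums

section Distances

variable {H : Type*} [NormedAddCommGroup H] [InnerProductSpace ℂ H]

theorem IsDensityOperator.nontrivial {ρ : H →L[ℂ] H} (hρ : IsDensityOperator ρ) :
    Nontrivial H := by
  by_contra h
  rw [not_nontrivial_iff_subsingleton] at h
  have hzero : (ρ : H →ₗ[ℂ] H) = 0 := Subsingleton.elim _ _
  simpa [hzero] using hρ.2

variable [FiniteDimensional ℂ H] [CompleteSpace H] [Nontrivial H] {m : ℕ} {n : Fin m → ℕ}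

theorem isLeast_chargingDistance_spectralSum {r : Fin m → ℝ} (hr : Function.Injective r)
    (b c : OrthonormalBasis (Σ i, Fin (n i)) ℂ H) :
    IsLeast (chargingTimes (spectralSum r b) (spectralSum r c))
      (chargingDistance (spectralSum r b) (spectralSum r c)) ∧
    IsLeast
      {x : ℝ | ∃ U : ∀ i, blockSpan c i ≃ₗᵢ[ℂ] blockSpan c i,
        x = normLog (blockSum (blockSpan c) U * ∑ i, ∑ k, ketBra (c ⟨i, k⟩) (b ⟨i, k⟩))}
      (chargingDistance (spectralSum r b) (spectralSum r c)) := by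
  obtain ⟨htimes, hleast⟩ := isLeast_chargingDistance ⟨_, sum_ketBra_mem_conjugators r b c⟩
  rw [conjugators_spectralSum hr, ← range_comp] at hleast
  exact ⟨htimes, by simpa only [range, Function.comp_apply, eq_comm] using hleast⟩

theorem chargingDistance_spectralSum_congr {r r' : Fin m → ℝ} (hr : Function.Injective r)
    (hr' : Function.Injective r') {b c b' c' : OrthonormalBasis (Σ i, Fin (n i)) ℂ H}
    (hb : ∀ i, blockSpan b' i = blockSpan b i) (hc : ∀ i, blockSpan c' i = blockSpan c i) :
    chargingDistance (spectralSum r' b') (spectralSum r' c') =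
      chargingDistance (spectralSum r b) (spectralSum r c) := by
  have hconj : conjugators (spectralSum r' b') (spectralSum r' c') =
      conjugators (spectralSum r b) (spectralSum r c) := by
    ext W
    simp only [mem_conjugators_spectralSum_iff hr, mem_conjugators_spectralSum_iff hr', hb, hc]
  have hleast := (isLeast_chargingDistance ⟨_, sum_ketBra_mem_conjugators r b c⟩).2
  have hleast' := (isLeast_chargingDistance ⟨_, sum_ketBra_mem_conjugators r' b' c'⟩).2
  exact (hconj ▸ hleast').unique hleast

theorem isLeast_chargingDistance_of_injective {ι : Type*} [Fintype ι] {a : ι → ℂ}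
    (ha : Function.Injective a) (b c : OrthonormalBasis ι ℂ H) :
    IsLeast
      {x : ℝ | ∃ φ : ι → ℝ,
        x = normLog (∑ i, Complex.exp (Complex.I * (φ i : ℂ)) • ketBra (c i) (b i))}
      (chargingDistance (∑ i, a i • ketBra (b i) (b i)) (∑ i, a i • ketBra (c i) (c i))) := by
  obtain ⟨-, hleast⟩ := isLeast_chargingDistance
    ⟨_, sum_smul_ketBra_mem_conjugators (u := 1) (fun _ => norm_one) a b c⟩
  rw [conjugators_of_injective ha, ← range_comp] at hleast
  simpa only [range, Function.comp_apply, eq_comm] using hleast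

end Distances

end QuantumCharging

open QuantumCharging in
theorem theorem4_general {H : Type*} [NormedAddCommGroup H] [InnerProductSpace ℂ H]
    [FiniteDimensional ℂ H] [CompleteSpace H] [Nontrivial H] :
    (∀ (m : ℕ) (n : Fin m → ℕ) (r : Fin m → ℝ) (b c : OrthonormalBasis (Σ i, Fin (n i)) ℂ H)
        (ρ σ : H →L[ℂ] H),
        Function.Injective r → ρ = spectralSum r b → σ = spectralSum r c →
        IsLeast (chargingTimes ρ σ) (chargingDistance ρ σ) ∧
        IsLeast
          {x : ℝ | ∃ U : ∀ i, blockSpan c i ≃ₗᵢ[ℂ] blockSpan c i,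
            x = normLog (blockSum (blockSpan c) U * ∑ i, ∑ k, ketBra (c ⟨i, k⟩) (b ⟨i, k⟩))}
          (chargingDistance ρ σ)) ∧
    (∀ (m : ℕ) (n : Fin m → ℕ) (r r' : Fin m → ℝ)
        (b c b' c' : OrthonormalBasis (Σ i, Fin (n i)) ℂ H) (ρ σ ρ' σ' : H →L[ℂ] H),
        Function.Injective r → Function.Injective r' →
        ρ = spectralSum r b → σ = spectralSum r c →
        ρ' = spectralSum r' b' → σ' = spectralSum r' c' →
        (∀ i, blockSpan b' i = blockSpan b i) → (∀ i, blockSpan c' i = blockSpan c i) →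
        chargingDistance ρ' σ' = chargingDistance ρ σ) ∧
    (∀ (d : ℕ) (r : Fin d → ℝ) (b c : OrthonormalBasis (Fin d) ℂ H) (ρ σ : H →L[ℂ] H),
        Function.Injective r →
        ρ = ∑ i, (r i : ℂ) • ketBra (b i) (b i) → σ = ∑ i, (r i : ℂ) • ketBra (c i) (c i) →
        IsLeast
          {x : ℝ | ∃ φ : Fin d → ℝ,
            x = normLog (∑ i, Complex.exp (Complex.I * (φ i : ℂ)) • ketBra (c i) (b i))}
          (chargingDistance ρ σ)) := by
  refine ⟨?_, ?_, ?_⟩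
  · rintro m n r b c _ _ hr rfl rfl
    exact isLeast_chargingDistance_spectralSum hr b c
  · rintro m n r r' b c b' c' _ _ _ _ hr hr' rfl rfl rfl rfl hb hc
    exact chargingDistance_spectralSum_congr hr hr' hb hc
  · rintro d r b c _ _ hr rfl rfl
    exact isLeast_chargingDistance_of_injective (Complex.ofReal_injective.comp hr) b c

open QuantumCharging in
theorem theorem4 {H : Type*} [NormedAddCommGroup H] [InnerProductSpace ℂ H]
    [FiniteDimensional ℂ H] [CompleteSpace H] :
    -- the formula for the charging distance, the minimum in its definition being attained
    (∀ (m : ℕ) (n : Fin m → ℕ) (r : Fin m → ℝ) (b c : OrthonormalBasis (Σ i, Fin (n i)) ℂ H)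
        (ρ σ : H →L[ℂ] H),
        Function.Injective r → IsDensityOperator ρ → IsDensityOperator σ →
        ρ = spectralSum r b → σ = spectralSum r c →
        IsLeast (chargingTimes ρ σ) (chargingDistance ρ σ) ∧
        IsLeast
          {x : ℝ | ∃ U : ∀ i, blockSpan c i ≃ₗᵢ[ℂ] blockSpan c i,
            x = normLog (blockSum (blockSpan c) U * ∑ i, ∑ k, ketBra (c ⟨i, k⟩) (b ⟨i, k⟩))}
          (chargingDistance ρ σ)) ∧
    -- the distance depends only on the eigenspaces, not on the eigenvalues
    (∀ (m : ℕ) (n : Fin m → ℕ) (r r' : Fin m → ℝ)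
        (b c b' c' : OrthonormalBasis (Σ i, Fin (n i)) ℂ H) (ρ σ ρ' σ' : H →L[ℂ] H),
        Function.Injective r → Function.Injective r' →
        IsDensityOperator ρ → IsDensityOperator σ →
        IsDensityOperator ρ' → IsDensityOperator σ' →
        ρ = spectralSum r b → σ = spectralSum r c →
        ρ' = spectralSum r' b' → σ' = spectralSum r' c' →
        (∀ i, blockSpan b' i = blockSpan b i) → (∀ i, blockSpan c' i = blockSpan c i) →
        chargingDistance ρ' σ' = chargingDistance ρ σ) ∧
    -- the non-degenerate case
    (∀ (d : ℕ) (r : Fin d → ℝ) (b c : OrthonormalBasis (Fin d) ℂ H) (ρ σ : H →L[ℂ] H),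
        Function.Injective r → IsDensityOperator ρ → IsDensityOperator σ →
        ρ = ∑ i, (r i : ℂ) • ketBra (b i) (b i) → σ = ∑ i, (r i : ℂ) • ketBra (c i) (c i) →
        IsLeast
          {x : ℝ | ∃ φ : Fin d → ℝ,
            x = normLog (∑ i, Complex.exp (Complex.I * (φ i : ℂ)) • ketBra (c i) (b i))}
          (chargingDistance ρ σ)) := by
  exact ⟨fun m n r b c ρ σ hr hρ _ =>
      have := hρ.nontrivial; theorem4_general.1 m n r b c ρ σ hr,
    fun m n r r' b c b' c' ρ σ ρ' σ' hr hr' hρ _ _ _ =>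
      have := hρ.nontrivial; theorem4_general.2.1 m n r r' b c b' c' ρ σ ρ' σ' hr hr',
    fun d r b c ρ σ hr hρ _ =>
      have := hρ.nontrivial; theorem4_general.2.2 d r b c ρ σ hr⟩
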